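/- Let $(n_k)_{k\ge1}$ be given by $n_k = 10^k$ if $k=10^s$ for some $s\in\{1,2,3,\dots\}$, and $n_k=2$ otherwise. For a sequence of integers $n_k\ge 2$ the cylinder of rank $m\ge1$ with base $a_1\dots a_m$ ($0\le a_k<n_k$) is the set of all $x=\sum_{k\ge1} \frac{e_k}{n_1\cdots n_k}$ with integers $0\le e_k<n_k$ for all $k$ and $e_k=a_k$ for $k\le m$; let $\Phi(C)$ be the family of all cylinders. A family $\Phi$ of subsets of $[0,1]$ is locally fine if for all $E\subseteq[0,1]$ and $\varepsilon>0$ there is an at most countable covering of $E$ by sets from $\Phi$ of diameter at most $\varepsilon$. For such a $\Phi$ and $\alpha\ge 0$ put $$H^\alpha(E,\Phi)=\lim_{\varepsilon\to0}\ \inf\Big\{\sum_j|E_j|^\alpha\Big\},\qquad \dim_H(E,\Phi)=\inf\{\alpha\ge0: H^\alpha(E,\Phi)=0\},$$ where the first infimum is over all at most countable coverings of $E$ by sets $E_j\in\Phi$ of diameter $|E_j|\le\varepsilon$. A locally fine $\Phi$ is faithful for the Hausdorff--Besicovitch dimension on $[0,1]$ if $\dim_H(E)=\dim_H(E,\Phi)$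 for every $E\subseteq[0,1]$, where $\dim_H(E)$ is the usual Hausdorff dimension. Then: (i) $n_k\ge2$ and $n_k\le 10^k$ for all $k\ge1$, so $(n_k)$ is a subgeometric basic sequence (i.e. $n_k\le q^k$ for all $k \ge 1$ and some positive integer $q$); (ii) $\frac{\ln n_k}{\ln(n_1 n_2\cdots n_{k-1})}$ does not tend to $0$ as $k\to\infty$; (iii) the family $\Phi(C)$ of cylinders of the Cantor series expansion generated by $(n_k)$ is locally fine but is not faithful for the Hausdorff--Besicovitch dimension on $[0,1]$. In particular, the conjecture that every subgeometric basic sequence generates a faithful family of cylinders is false. -/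

import Mathlib

open scoped NNReal ENNReal
open Set Filter Topology

namespace CantorSeries

/-! ### Covering families and the Hausdorff–Besicovitch dimension they generate -/

/-- `C` is an at most countable `ε`-covering of `E` by sets of the family `Φ`. -/
def IsEpsCover (Φ : Set (Set ℝ)) (ε : ℝ≥0∞) (E : Set ℝ) (C : Set (Set ℝ)) : Prop :=
  C.Countable ∧ C ⊆ Φ ∧ E ⊆ ⋃₀ C ∧ ∀ V ∈ C, Metric.ediam V ≤ ε

/-- `Φ` is a locally fine family of subsets of `[0,1]`: every `E ⊆ [0,1]` has, for every `ε > 0`,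
an at most countable `ε`-covering by sets of `Φ`. -/
def IsLocallyFine (Φ : Set (Set ℝ)) : Prop :=
  (∀ V ∈ Φ, V ⊆ Icc (0 : ℝ) 1) ∧
    ∀ E ⊆ Icc (0 : ℝ) 1, ∀ ε : ℝ≥0∞, 0 < ε → ∃ C, IsEpsCover Φ ε E C

/-- `H^α_ε(E, Φ)`: the infimum of `∑ |E_j|^α` over the `ε`-coverings of `E` by sets of `Φ`. -/
noncomputable def preHausdorff (Φ : Set (Set ℝ)) (α : ℝ≥0) (ε : ℝ≥0∞) (E : Set ℝ) : ℝ≥0∞ :=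
  ⨅ (C : Set (Set ℝ)) (_ : IsEpsCover Φ ε E C), ∑' V : C, Metric.ediam (V : Set ℝ) ^ (α : ℝ)

/-- `H^α(E, Φ) = lim_{ε → 0} H^α_ε(E, Φ)`. Since `H^α_ε` increases as `ε` decreases, the limit is
the supremum over `ε > 0`. -/
noncomputable def hausdorffOf (Φ : Set (Set ℝ)) (α : ℝ≥0) (E : Set ℝ) : ℝ≥0∞ :=
  ⨆ (ε : ℝ≥0∞) (_ : 0 < ε), preHausdorff Φ α ε E

/-- `dim_H(E, Φ) = inf {α ≥ 0 : H^α(E, Φ) = 0}`. -/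
noncomputable def dimHOf (Φ : Set (Set ℝ)) (E : Set ℝ) : ℝ≥0∞ :=
  ⨅ (α : ℝ≥0) (_ : hausdorffOf Φ α E = 0), (α : ℝ≥0∞)

/-- A locally fine family `Φ` is faithful for the Hausdorff–Besicovitch dimension on `[0,1]` if
`dim_H(E) = dim_H(E, Φ)` for every `E ⊆ [0,1]`. -/
def IsFaithful (Φ : Set (Set ℝ)) : Prop :=
  IsLocallyFine Φ ∧ ∀ E ⊆ Icc (0 : ℝ) 1, dimH E = dimHOf Φ E

/-! ### Cantor series expansions

Sequences are indexed by `k = 1, 2, 3, …`; their value at `0` is never used. -/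

/-- A basic sequence: integers `n_k ≥ 2`, `k ≥ 1`. -/
def IsBasicSeq (n : ℕ → ℕ) : Prop := ∀ k, 1 ≤ k → 2 ≤ n k

/-- A sequence is subgeometric if `n_k ≤ q^k` for all `k ≥ 1` and some positive integer `q`. -/
def IsSubgeometric (n : ℕ → ℕ) : Prop := ∃ q : ℕ, 0 < q ∧ ∀ k, 1 ≤ k → n k ≤ q ^ k

/-- The partial product `n_1 n_2 ⋯ n_k`. -/
def partialProd (n : ℕ → ℕ) (k : ℕ) : ℕ := ∏ i ∈ Finset.Icc 1 k, n i

/-- `x = ∑_{k ≥ 1} e_k / (n_1 ⋯ n_k)` with digits `e_k ∈ {0, …, n_k - 1}`. -/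
def IsExpansion (n e : ℕ → ℕ) (x : ℝ) : Prop :=
  (∀ k, 1 ≤ k → e k < n k) ∧
    HasSum (fun k : ℕ => (e (k + 1) : ℝ) / (partialProd n (k + 1) : ℝ)) x

/-- The cylinder of rank `m` with base `a_1 … a_m`: all numbers having a Cantor series expansion
whose first `m` digits are `a_1, …, a_m`. -/
def cylinder (n : ℕ → ℕ) (m : ℕ) (a : ℕ → ℕ) : Set ℝ :=
  {x | ∃ e : ℕ → ℕ, IsExpansion n e x ∧ ∀ k, 1 ≤ k → k ≤ m → e k = a k}

/-- The family `Φ(C)` of all cylinders (of ranks `m ≥ 1`) of the Cantor series expansion. -/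
def cylinders (n : ℕ → ℕ) : Set (Set ℝ) :=
  {V | ∃ (m : ℕ) (a : ℕ → ℕ), 1 ≤ m ∧ (∀ k, 1 ≤ k → k ≤ m → a k < n k) ∧ V = cylinder n m a}

open Classical in
/-- `n_k = 10^k` if `k = 10^s` for some `s = 1, 2, 3, …`, and `n_k = 2` otherwise. -/
noncomputable def sparseSeq (k : ℕ) : ℕ :=
  if ∃ s : ℕ, 1 ≤ s ∧ k = 10 ^ s then 10 ^ k else 2

end CantorSeries

/-!
Write `P_m = n_1 ⋯ n_m`. The family of cylinders fails to be faithful because, at the places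
`k = 10 ^ s`, the factor `n_k = 10 ^ k` is larger than `P_{k-1}`. A cylinder of rank `k - 1` splits
into so many cylinders of rank `k` that nothing of intermediate size is available for coverings.

The witness is the Cantor set `E` whose digits satisfy `e_k < n'_k`, where `n'_k = 10 ^ (k / 2)` is
the square root of `n_k` at the places `k = 10 ^ s`, and `n'_k = n_k = 2` elsewhere. Let
`Q_m = n'_1 ⋯ n'_m`, and let `D_m` be the product of those `n_k`, `k ≤ m`, that are equal to `2`.
Then `P_m D_m = Q_m ^ 2`.

* Let `k = 10 ^ s`. The part of `E` in one cylinder of rank `k - 1` lies in the first `n'_k`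
  cylinders of rank `k`, hence in an interval of length `n'_k / P_k`. These `Q_{k-1}` intervals have
  cost `Q_{k-1} (n'_k / P_k) ^ (1/2) = (D_{k-1} / n'_k) ^ (1/2) ≤ 1`, as
  `D_{k-1} ≤ 2 ^ k ≤ 10 ^ (k / 2)`. So the Hausdorff dimension of `E` is at most `1/2`
  (`dimH_transfer_le`, `sparse_cover_cost_le`).

* Cylinders cannot use these intervals. Let `g` send `y ∈ [0,1)` to the number whose digits with
  respect to `n` are those of `y` with respect to `n'`, so that `E` is taken to be the image of `g`.
  The map `g` does not bring prefixes closer together (`prefixNum_digit_add_floor_le`), so that the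
  preimage of a cylinder of rank `m` has diameter at most `3 / Q_m`. The large factors are sparse
  enough for `P_m ≤ D_m ^ 10` (`partialProd_sparseSeq_le_pow`), which amounts to
  `1 / Q_m ≤ (1 / P_m) ^ (11/20)`. As the preimages of a covering of `E` cover `[0,1)`,
  subadditivity of Lebesgue measure bounds the cost of every covering by cylinders from below, and
  the dimension of `E` with respect to cylinders is at least `11/20` (`le_dimHOf_transfer`).
-/

namespace CantorSeries

/-! ### Prefixes of Cantor series expansions -/

/-- The integer `A_m` with `∑_{k ≤ m} e_k / (n_1 ⋯ n_k) = A_m / (n_1 ⋯ n_m)`. -/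
def prefixNum (n e : ℕ → ℕ) : ℕ → ℕ
  | 0 => 0
  | m + 1 => n (m + 1) * prefixNum n e m + e (m + 1)

lemma partialProd_zero (n : ℕ → ℕ) : partialProd n 0 = 1 := by simp [partialProd]

lemma partialProd_succ (n : ℕ → ℕ) (m : ℕ) :
    partialProd n (m + 1) = partialProd n m * n (m + 1) := by
  simp [partialProd, Finset.prod_Icc_succ_top]

lemma two_pow_le_partialProd {n : ℕ → ℕ} (hn : IsBasicSeq n) (m : ℕ) :
    2 ^ m ≤ partialProd n m := by
  induction m with
  | zero => simp [partialProd_zero]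
  | succ m ih =>
    rw [partialProd_succ, pow_succ]
    exact Nat.mul_le_mul ih (hn _ (by omega))

lemma partialProd_pos {n : ℕ → ℕ} (hn : IsBasicSeq n) (m : ℕ) : 0 < partialProd n m :=
  lt_of_lt_of_le (by positivity) (two_pow_le_partialProd hn m)

lemma tendsto_partialProd {n : ℕ → ℕ} (hn : IsBasicSeq n) :
    Tendsto (fun m => (partialProd n m : ℝ)) atTop atTop :=
  tendsto_natCast_atTop_atTop.comp <|
    tendsto_atTop_mono (two_pow_le_partialProd hn) (tendsto_pow_atTop_atTop_of_one_lt one_lt_two)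

lemma sum_range_eq_prefixNum_div {n : ℕ → ℕ} (hn : IsBasicSeq n) (e : ℕ → ℕ) (m : ℕ) :
    ∑ k ∈ Finset.range m, (e (k + 1) : ℝ) / (partialProd n (k + 1) : ℝ) =
      prefixNum n e m / partialProd n m := by
  induction m with
  | zero => simp [prefixNum]
  | succ m ih =>
    have h1 : (partialProd n m : ℝ) ≠ 0 := by exact_mod_cast (partialProd_pos hn m).ne'
    have h2 : (n (m + 1) : ℝ) ≠ 0 := by
      have := hn (m + 1) (by omega)
      exact_mod_cast (by omega : n (m + 1) ≠ 0)
    rw [Finset.sum_range_succ, ih, partialProd_succ, prefixNum]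
    push_cast
    field_simp

/-- Since the terms are nonnegative, an expansion converges to `x` exactly when its prefixes do. -/
lemma isExpansion_iff_tendsto {n : ℕ → ℕ} (hn : IsBasicSeq n) {e : ℕ → ℕ} {x : ℝ} :
    IsExpansion n e x ↔ (∀ k, 1 ≤ k → e k < n k) ∧
      Tendsto (fun m => (prefixNum n e m : ℝ) / partialProd n m) atTop (𝓝 x) := by
  unfold IsExpansion
  rw [hasSum_iff_tendsto_nat_of_nonneg (fun k => by positivity)]
  simp_rw [sum_range_eq_prefixNum_div hn]

lemma monotone_prefixNum_div {n : ℕ → ℕ} (hn : IsBasicSeq n) (e : ℕ → ℕ) :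
    Monotone (fun m => (prefixNum n e m : ℝ) / partialProd n m) := by
  simp_rw [← sum_range_eq_prefixNum_div hn]
  refine monotone_nat_of_le_succ fun m => ?_
  rw [Finset.sum_range_succ]
  exact le_add_of_nonneg_right (by positivity)

lemma antitone_prefixNum_succ_div {n : ℕ → ℕ} (hn : IsBasicSeq n) {e : ℕ → ℕ}
    (he : ∀ k, 1 ≤ k → e k < n k) :
    Antitone (fun m => ((prefixNum n e m : ℝ) + 1) / partialProd n m) := by
  refine antitone_nat_of_succ_le fun m => ?_
  have h1 : (0 : ℝ) < partialProd n m := by exact_mod_cast partialProd_pos hn m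
  have h2 : (0 : ℝ) < partialProd n (m + 1) := by exact_mod_cast partialProd_pos hn (m + 1)
  have h3 : (e (m + 1) : ℝ) + 1 ≤ n (m + 1) := by exact_mod_cast he (m + 1) (by omega)
  rw [div_le_div_iff₀ h2 h1, partialProd_succ, prefixNum]
  push_cast
  nlinarith

lemma tendsto_prefixNum_succ_div {n : ℕ → ℕ} (hn : IsBasicSeq n) {e : ℕ → ℕ} {x : ℝ} :
    Tendsto (fun m => ((prefixNum n e m : ℝ) + 1) / partialProd n m) atTop (𝓝 x) ↔
      Tendsto (fun m => (prefixNum n e m : ℝ) / partialProd n m) atTop (𝓝 x) := by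
  have h0 := (tendsto_partialProd hn).inv_tendsto_atTop
  constructor <;> intro h
  · refine (by simpa using h.sub h0 : Tendsto _ _ (𝓝 x)).congr fun m => ?_
    simp [add_div]
  · refine (by simpa using h.add h0 : Tendsto _ _ (𝓝 x)).congr fun m => ?_
    simp [add_div]

lemma IsExpansion.prefix_le {n e : ℕ → ℕ} {x : ℝ} (hn : IsBasicSeq n) (h : IsExpansion n e x)
    (m : ℕ) : (prefixNum n e m : ℝ) / partialProd n m ≤ x :=
  (monotone_prefixNum_div hn e).ge_of_tendsto ((isExpansion_iff_tendsto hn).1 h).2 m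

lemma IsExpansion.le_prefix {n e : ℕ → ℕ} {x : ℝ} (hn : IsBasicSeq n) (h : IsExpansion n e x)
    (m : ℕ) : x ≤ ((prefixNum n e m : ℝ) + 1) / partialProd n m :=
  (antitone_prefixNum_succ_div hn h.1).le_of_tendsto
    ((tendsto_prefixNum_succ_div hn).2 ((isExpansion_iff_tendsto hn).1 h).2) m

lemma IsExpansion.mem_Icc {n e : ℕ → ℕ} {x : ℝ} (hn : IsBasicSeq n) (h : IsExpansion n e x) :
    x ∈ Icc (0 : ℝ) 1 := by
  simpa [prefixNum, partialProd_zero] using And.intro (h.prefix_le hn 0) (h.le_prefix hn 0)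

/-- Every admissible sequence of digits is the expansion of some number. -/
lemma isExpansion_tsum {n e : ℕ → ℕ} (hn : IsBasicSeq n) (he : ∀ k, 1 ≤ k → e k < n k) :
    IsExpansion n e (∑' k : ℕ, (e (k + 1) : ℝ) / (partialProd n (k + 1) : ℝ)) := by
  refine ⟨he, (summable_of_sum_range_le (c := 1) (fun k => by positivity) fun m => ?_).hasSum⟩
  rw [sum_range_eq_prefixNum_div hn]
  calc (prefixNum n e m : ℝ) / partialProd n m
      ≤ ((prefixNum n e m : ℝ) + 1) / partialProd n m := by gcongr; linarith
    _ ≤ ((prefixNum n e 0 : ℝ) + 1) / partialProd n 0 :=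
        antitone_prefixNum_succ_div hn he (Nat.zero_le m)
    _ = 1 := by simp [prefixNum, partialProd_zero]

lemma prefixNum_congr {n e f : ℕ → ℕ} {m : ℕ} (h : ∀ k, 1 ≤ k → k ≤ m → e k = f k) :
    prefixNum n e m = prefixNum n f m := by
  induction m with
  | zero => rfl
  | succ m ih =>
    rw [prefixNum, prefixNum, ih fun k h1 h2 => h k h1 (by omega), h (m + 1) (by omega) le_rfl]

/-! ### Cylinders -/

lemma cylinder_subset_Icc {n : ℕ → ℕ} (hn : IsBasicSeq n) (m : ℕ) (a : ℕ → ℕ) :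
    cylinder n m a ⊆ Icc ((prefixNum n a m : ℝ) / partialProd n m)
      (((prefixNum n a m : ℝ) + 1) / partialProd n m) := by
  rintro x ⟨e, he, hea⟩
  rw [← prefixNum_congr hea]
  exact ⟨he.prefix_le hn m, he.le_prefix hn m⟩

/-- The left endpoint of a cylinder is its element all of whose free digits are `0`. -/
lemma left_mem_cylinder {n a : ℕ → ℕ} (hn : IsBasicSeq n) {m : ℕ}
    (ha : ∀ k, 1 ≤ k → k ≤ m → a k < n k) :
    (prefixNum n a m : ℝ) / partialProd n m ∈ cylinder n m a := by
  let e : ℕ → ℕ := fun k => if k ≤ m then a k else 0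
  have hea : ∀ k, 1 ≤ k → k ≤ m → e k = a k := fun k _ h => if_pos h
  refine ⟨e, (isExpansion_iff_tendsto hn).2 ⟨fun k hk => ?_, ?_⟩, hea⟩
  · by_cases h : k ≤ m
    · simpa [e, h] using ha k hk h
    · simpa [e, h] using lt_of_lt_of_le two_pos (hn k hk)
  · refine tendsto_atTop_of_eventually_const (i₀ := m) fun M hM => ?_
    induction M, hM using Nat.le_induction with
    | base => rw [prefixNum_congr hea]
    | succ M hM ih =>
      have h2 := hn (M + 1) (by omega)
      have h3 : (n (M + 1) : ℝ) ≠ 0 := by exact_mod_cast (by omega : n (M + 1) ≠ 0)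
      rw [← ih, prefixNum, partialProd_succ, show e (M + 1) = 0 from if_neg (by omega)]
      push_cast
      rw [add_zero, mul_comm, mul_div_mul_right _ _ h3]

/-- The right endpoint of a cylinder is its element all of whose free digits are maximal. -/
lemma right_mem_cylinder {n a : ℕ → ℕ} (hn : IsBasicSeq n) {m : ℕ}
    (ha : ∀ k, 1 ≤ k → k ≤ m → a k < n k) :
    ((prefixNum n a m : ℝ) + 1) / partialProd n m ∈ cylinder n m a := by
  let e : ℕ → ℕ := fun k => if k ≤ m then a k else n k - 1
  have hea : ∀ k, 1 ≤ k → k ≤ m → e k = a k := fun k _ h => if_pos h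
  refine ⟨e, (isExpansion_iff_tendsto hn).2 ⟨fun k hk => ?_, ?_⟩, hea⟩
  · have := hn k hk
    by_cases h : k ≤ m
    · simpa [e, h] using ha k hk h
    · simp only [e, h, if_false]; omega
  · rw [← tendsto_prefixNum_succ_div hn]
    refine tendsto_atTop_of_eventually_const (i₀ := m) fun M hM => ?_
    induction M, hM using Nat.le_induction with
    | base => rw [prefixNum_congr hea]
    | succ M hM ih =>
      have h2 := hn (M + 1) (by omega)
      have h3 : (n (M + 1) : ℝ) ≠ 0 := by exact_mod_cast (by omega : n (M + 1) ≠ 0)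
      rw [← ih, prefixNum, partialProd_succ, show e (M + 1) = n (M + 1) - 1 from if_neg (by omega)]
      rw [← mul_div_mul_right ((prefixNum n e M : ℝ) + 1) _ h3]
      push_cast [Nat.cast_sub (by omega : 1 ≤ n (M + 1))]
      ring

lemma ediam_cylinder {n a : ℕ → ℕ} (hn : IsBasicSeq n) {m : ℕ}
    (ha : ∀ k, 1 ≤ k → k ≤ m → a k < n k) :
    Metric.ediam (cylinder n m a) = ENNReal.ofReal (1 / partialProd n m) := by
  have h : ((prefixNum n a m : ℝ) + 1) / partialProd n m -
      (prefixNum n a m : ℝ) / partialProd n m = 1 / partialProd n m := by ring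
  apply le_antisymm
  · calc _ ≤ _ := Metric.ediam_mono (cylinder_subset_Icc hn m a)
      _ = _ := by rw [Real.ediam_Icc, h]
  · calc _ = edist (((prefixNum n a m : ℝ) + 1) / partialProd n m)
          ((prefixNum n a m : ℝ) / partialProd n m) := by
          rw [edist_dist, Real.dist_eq, h, abs_of_nonneg (by positivity)]
      _ ≤ _ := Metric.edist_le_ediam_of_mem (right_mem_cylinder hn ha) (left_mem_cylinder hn ha)

lemma countable_cylinders (n : ℕ → ℕ) : (cylinders n).Countable := by
  let F : (Σ m : ℕ, Fin (m + 1) → ℕ) → Set ℝ := fun p =>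
    cylinder n p.1 fun k => if h : k < p.1 + 1 then p.2 ⟨k, h⟩ else 0
  refine (countable_range F).mono ?_
  rintro V ⟨m, a, -, -, rfl⟩
  refine ⟨⟨m, fun k => a k⟩, ?_⟩
  ext x
  simp only [F, cylinder, mem_ofPred_eq]
  refine exists_congr fun e => and_congr_right fun _ => forall_congr' fun k => ?_
  refine forall_congr' fun _ => forall_congr' fun hk => ?_
  simp [Nat.lt_succ_of_le hk]

/-! ### Digits of a number -/

/-- The `k`-th digit of `y ∈ [0,1)` in the Cantor series expansion generated by `n`. -/
noncomputable def digit (n : ℕ → ℕ) (y : ℝ) (k : ℕ) : ℕ := ⌊y * partialProd n k⌋₊ % n k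

lemma digit_lt {n : ℕ → ℕ} (hn : IsBasicSeq n) (y : ℝ) {k : ℕ} (hk : 1 ≤ k) :
    digit n y k < n k :=
  Nat.mod_lt _ (lt_of_lt_of_le two_pos (hn k hk))

lemma floor_mul_partialProd {n : ℕ → ℕ} (hn : IsBasicSeq n) (y : ℝ) (m : ℕ) :
    ⌊y * partialProd n m⌋₊ = ⌊y * partialProd n (m + 1)⌋₊ / n (m + 1) := by
  have h2 := hn (m + 1) (by omega)
  have h3 : (n (m + 1) : ℝ) ≠ 0 := by exact_mod_cast (by omega : n (m + 1) ≠ 0)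
  rw [← Nat.floor_div_natCast, partialProd_succ]
  push_cast
  rw [← mul_assoc, mul_div_cancel_right₀ _ h3]

lemma floor_mul_partialProd_succ {n : ℕ → ℕ} (hn : IsBasicSeq n) (y : ℝ) (m : ℕ) :
    ⌊y * partialProd n (m + 1)⌋₊ =
      n (m + 1) * ⌊y * partialProd n m⌋₊ + digit n y (m + 1) := by
  rw [floor_mul_partialProd hn y m, digit, Nat.div_add_mod]

lemma prefixNum_digit {n : ℕ → ℕ} (hn : IsBasicSeq n) {y : ℝ} (hy : y < 1) (m : ℕ) :
    prefixNum n (digit n y) m = ⌊y * partialProd n m⌋₊ := by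
  induction m with
  | zero => simpa [prefixNum, partialProd_zero, eq_comm, Nat.floor_eq_zero] using hy
  | succ m ih => rw [prefixNum, ih, floor_mul_partialProd_succ hn]

lemma isExpansion_digit {n : ℕ → ℕ} (hn : IsBasicSeq n) {y : ℝ} (hy : y ∈ Ico (0 : ℝ) 1) :
    IsExpansion n (digit n y) y := by
  refine (isExpansion_iff_tendsto hn).2 ⟨fun k => digit_lt hn y, ?_⟩
  simp_rw [prefixNum_digit hn hy.2]
  exact (tendsto_nat_floor_mul_div_atTop hy.1).comp (tendsto_partialProd hn)

lemma exists_isExpansion {n : ℕ → ℕ} (hn : IsBasicSeq n) {x : ℝ} (hx : x ∈ Icc (0 : ℝ) 1) :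
    ∃ e, IsExpansion n e x := by
  rcases hx.2.lt_or_eq with h | rfl
  · exact ⟨_, isExpansion_digit hn ⟨hx.1, h⟩⟩
  · have := right_mem_cylinder (n := n) (a := 0) (m := 0) hn (by intros; omega)
    obtain ⟨e, he, -⟩ := this
    exact ⟨e, by simpa [prefixNum, partialProd_zero] using he⟩

theorem isLocallyFine_cylinders {n : ℕ → ℕ} (hn : IsBasicSeq n) :
    IsLocallyFine (cylinders n) := by
  constructor
  · rintro V ⟨m, a, -, -, rfl⟩ x ⟨e, he, -⟩
    exact he.mem_Icc hn
  · intro E hE ε hε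
    have hlim : Tendsto (fun m => ENNReal.ofReal (1 / (partialProd n m : ℝ))) atTop (𝓝 0) := by
      simpa using ENNReal.tendsto_ofReal (tendsto_partialProd hn).inv_tendsto_atTop
    obtain ⟨m, hm, hm1⟩ := ((hlim.eventually_le_const hε).and (eventually_ge_atTop 1)).exists
    refine ⟨{V | ∃ a : ℕ → ℕ, (∀ k, 1 ≤ k → k ≤ m → a k < n k) ∧ V = cylinder n m a},
      (countable_cylinders n).mono ?_, ?_, fun x hx => ?_, ?_⟩
    · rintro V ⟨a, ha, rfl⟩
      exact ⟨m, a, hm1, ha, rfl⟩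
    · rintro V ⟨a, ha, rfl⟩
      exact ⟨m, a, hm1, ha, rfl⟩
    · obtain ⟨e, he⟩ := exists_isExpansion hn (hE hx)
      exact ⟨_, ⟨e, fun k hk _ => he.1 k hk, rfl⟩, e, he, fun _ _ _ => rfl⟩
    · rintro V ⟨a, ha, rfl⟩
      rwa [ediam_cylinder hn ha]

/-! ### Transferring digits from one basic sequence to a larger one -/

/-- The number whose expansion with respect to `n` has the digits of `y` with respect to `n'`. For
`n' ≤ n` the image of `[0,1)` is a Cantor set: only the digits `e_k < n'_k` occur in it. -/
noncomputable def transfer (n n' : ℕ → ℕ) (y : ℝ) : ℝ :=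
  ∑' k : ℕ, (digit n' y (k + 1) : ℝ) / (partialProd n (k + 1) : ℝ)

lemma isExpansion_transfer {n n' : ℕ → ℕ} (hn : IsBasicSeq n) (hn' : IsBasicSeq n')
    (hle : ∀ k, 1 ≤ k → n' k ≤ n k) (y : ℝ) :
    IsExpansion n (digit n' y) (transfer n n' y) :=
  isExpansion_tsum hn fun k hk => (digit_lt hn' y hk).trans_le (hle k hk)

/-- Transferring digits to a larger basic sequence does not decrease the distance between prefixes,
measured in cylinders of rank `m`. -/
lemma prefixNum_digit_add_floor_le {n n' : ℕ → ℕ} (hn' : IsBasicSeq n')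
    (hle : ∀ k, 1 ≤ k → n' k ≤ n k) {y z : ℝ} (hyz : y ≤ z) (m : ℕ) (hz : z < 1) :
    prefixNum n (digit n' y) m + ⌊z * partialProd n' m⌋₊ ≤
      prefixNum n (digit n' z) m + ⌊y * partialProd n' m⌋₊ := by
  induction m with
  | zero =>
    simp [prefixNum, partialProd_zero, Nat.floor_eq_zero.2 hz]
  | succ m ih =>
    have hB : ⌊y * partialProd n' m⌋₊ ≤ ⌊z * partialProd n' m⌋₊ := by gcongr
    have hl := hle (m + 1) (by omega)
    rw [floor_mul_partialProd_succ hn', floor_mul_partialProd_succ hn', prefixNum, prefixNum]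
    nlinarith

/-- The numbers transferred into one cylinder of rank `m` lie in three consecutive cylinders of
rank `m` of the smaller sequence. -/
lemma ediam_transfer_preimage_le {n n' a : ℕ → ℕ} (hn : IsBasicSeq n) (hn' : IsBasicSeq n')
    (hle : ∀ k, 1 ≤ k → n' k ≤ n k) (m : ℕ) :
    Metric.ediam (Ico (0 : ℝ) 1 ∩ transfer n n' ⁻¹' cylinder n m a) ≤
      ENNReal.ofReal (3 / partialProd n' m) := by
  have hP : (0 : ℝ) < partialProd n m := by exact_mod_cast partialProd_pos hn m
  have hQ : (0 : ℝ) < partialProd n' m := by exact_mod_cast partialProd_pos hn' m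
  have key : ∀ y ∈ Ico (0 : ℝ) 1 ∩ transfer n n' ⁻¹' cylinder n m a,
      ∀ z ∈ Ico (0 : ℝ) 1 ∩ transfer n n' ⁻¹' cylinder n m a, y ≤ z →
      z - y ≤ 3 / partialProd n' m := by
    rintro y ⟨hy, hyV⟩ z ⟨hz, hzV⟩ hyz
    have h1 := (isExpansion_transfer hn hn' hle y).le_prefix hn m
    have h2 := (isExpansion_transfer hn hn' hle z).prefix_le hn m
    have h3 := (cylinder_subset_Icc hn m a hyV).1
    have h4 := (cylinder_subset_Icc hn m a hzV).2
    have h5 := h3.trans h1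
    have h6 := h2.trans h4
    rw [div_le_div_iff_of_pos_right hP] at h5 h6
    have h7 := prefixNum_digit_add_floor_le hn' hle hyz m hz.2
    have h8 : (prefixNum n (digit n' y) m : ℝ) + ⌊z * partialProd n' m⌋₊ ≤
      prefixNum n (digit n' z) m + ⌊y * partialProd n' m⌋₊ := by exact_mod_cast h7
    have h9 := Nat.lt_floor_add_one (z * partialProd n' m)
    have h10 := Nat.floor_le (mul_nonneg hy.1 hQ.le)
    rw [le_div_iff₀ hQ]
    linarith
  refine Metric.ediam_le fun y hy z hz => ?_
  rw [edist_dist, Real.dist_eq]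
  refine ENNReal.ofReal_le_ofReal (abs_sub_le_iff.2 ⟨?_, ?_⟩)
  · rcases le_total z y with h | h
    · exact key z hz y hy h
    · exact (sub_nonpos.2 h).trans (by positivity)
  · rcases le_total y z with h | h
    · exact key y hy z hz h
    · exact (sub_nonpos.2 h).trans (by positivity)

/-- Mass distribution principle: if the rank-`m` cylinders of `n` are at least as large as
`(n'_1 ⋯ n'_m)⁻¹` when raised to the power `β`, then every covering of the Cantor set by cylinders
costs at least `1/3`, because the preimages cover `[0,1)`. -/
theorem le_dimHOf_transfer {n n' : ℕ → ℕ} (hn : IsBasicSeq n) (hn' : IsBasicSeq n')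
    (hle : ∀ k, 1 ≤ k → n' k ≤ n k) {β : ℝ≥0}
    (hβ : ∀ m, (partialProd n m : ℝ) ^ (β : ℝ) ≤ partialProd n' m) :
    (β : ℝ≥0∞) ≤ dimHOf (cylinders n) (transfer n n' '' Ico 0 1) := by
  refine le_iInf₂ fun α hα => ?_
  by_contra! hlt
  have hαβ : (α : ℝ) ≤ β := by exact_mod_cast hlt.le
  have hV : ∀ V ∈ cylinders n, MeasureTheory.volume (Ico (0 : ℝ) 1 ∩ transfer n n' ⁻¹' V) ≤
      3 * Metric.ediam V ^ (α : ℝ) := by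
    rintro V ⟨m, a, -, ha, rfl⟩
    have hP : (1 : ℝ) ≤ partialProd n m := by exact_mod_cast partialProd_pos hn m
    have hP0 : (0 : ℝ) < partialProd n m := by linarith
    refine (Real.volume_le_diam _).trans ((ediam_transfer_preimage_le hn hn' hle m).trans ?_)
    rw [ediam_cylinder hn ha, ENNReal.ofReal_rpow_of_nonneg (by positivity) α.coe_nonneg,
      ← ENNReal.ofReal_ofNat 3, ← ENNReal.ofReal_mul (by norm_num)]
    refine ENNReal.ofReal_le_ofReal ?_
    rw [div_eq_mul_one_div, one_div (partialProd n m : ℝ), Real.inv_rpow hP0.le, ← one_div]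
    have := (Real.rpow_le_rpow_of_exponent_le hP hαβ).trans (hβ m)
    gcongr
  have hpre : (1 : ℝ≥0∞) ≤ 3 * preHausdorff (cylinders n) α 1 (transfer n n' '' Ico 0 1) := by
    unfold preHausdorff
    rw [ENNReal.mul_iInf_of_ne (by norm_num) (by norm_num)]
    refine le_iInf fun C => ?_
    rw [ENNReal.mul_iInf_of_ne (by norm_num) (by norm_num)]
    refine le_iInf fun hC => ?_
    calc (1 : ℝ≥0∞) = MeasureTheory.volume (Ico (0 : ℝ) 1) := by simp
      _ ≤ MeasureTheory.volume (⋃ V ∈ C, Ico (0 : ℝ) 1 ∩ transfer n n' ⁻¹' V) := by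
        refine MeasureTheory.measure_mono fun y hy => ?_
        obtain ⟨V, hVC, hyV⟩ := hC.2.2.1 (mem_image_of_mem _ hy)
        exact mem_biUnion hVC ⟨hy, hyV⟩
      _ ≤ ∑' V : C, MeasureTheory.volume (Ico (0 : ℝ) 1 ∩ transfer n n' ⁻¹' (V : Set ℝ)) :=
        MeasureTheory.measure_biUnion_le _ hC.1 _
      _ ≤ ∑' V : C, 3 * Metric.ediam (V : Set ℝ) ^ (α : ℝ) :=
        ENNReal.tsum_le_tsum fun V => hV V (hC.2.1 V.2)
      _ = _ := ENNReal.tsum_mul_left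
  have h0 : preHausdorff (cylinders n) α 1 (transfer n n' '' Ico 0 1) ≤ 0 :=
    hα ▸ le_iSup₂ (f := fun (ε : ℝ≥0∞) (_ : 0 < ε) =>
      preHausdorff (cylinders n) α ε (transfer n n' '' Ico 0 1)) 1 one_pos
  rw [nonpos_iff_eq_zero.1 h0] at hpre
  simp at hpre

lemma prefixNum_digit_congr {n n' : ℕ → ℕ} (hn' : IsBasicSeq n') {y z : ℝ} {m : ℕ}
    (h : ⌊y * partialProd n' m⌋₊ = ⌊z * partialProd n' m⌋₊) :
    prefixNum n (digit n' y) m = prefixNum n (digit n' z) m := by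
  induction m with
  | zero => rfl
  | succ m ih =>
    rw [prefixNum, prefixNum, digit, digit, h, ih]
    rw [floor_mul_partialProd hn', h, ← floor_mul_partialProd hn']

/-- Within a cylinder of rank `m`, the Cantor set meets only the first `n'_{m+1}` of the cylinders
of rank `m + 1`. These are consecutive, so that a single short interval covers all of them. -/
lemma ediam_transfer_image_le {n n' : ℕ → ℕ} (hn : IsBasicSeq n) (hn' : IsBasicSeq n')
    (hle : ∀ k, 1 ≤ k → n' k ≤ n k) (m j : ℕ) :
    Metric.ediam (transfer n n' '' {y | ⌊y * partialProd n' m⌋₊ = j}) ≤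
      ENNReal.ofReal ((n' (m + 1) : ℝ) / partialProd n (m + 1)) := by
  have hP : (0 : ℝ) < partialProd n (m + 1) := by exact_mod_cast partialProd_pos hn (m + 1)
  have key : ∀ y z : ℝ, ⌊y * partialProd n' m⌋₊ = ⌊z * partialProd n' m⌋₊ →
      transfer n n' y - transfer n n' z ≤ (n' (m + 1) : ℝ) / partialProd n (m + 1) := by
    intro y z h
    have h1 := (isExpansion_transfer hn hn' hle y).le_prefix hn (m + 1)
    have h2 := (isExpansion_transfer hn hn' hle z).prefix_le hn (m + 1)
    have h3 : (digit n' y (m + 1) : ℝ) + 1 ≤ n' (m + 1) := by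
      exact_mod_cast digit_lt hn' y (by omega : 1 ≤ m + 1)
    rw [prefixNum] at h1 h2
    rw [prefixNum_digit_congr hn' h] at h1
    rw [le_div_iff₀ hP] at h1 ⊢
    rw [div_le_iff₀ hP] at h2
    push_cast at h1 h2
    have h4 : (0 : ℝ) ≤ digit n' z (m + 1) := by positivity
    linarith
  refine Metric.ediam_le ?_
  rintro _ ⟨y, hy, rfl⟩ _ ⟨z, hz, rfl⟩
  rw [edist_dist, Real.dist_eq]
  exact ENNReal.ofReal_le_ofReal
    (abs_sub_le_iff.2 ⟨key y z (hy.trans hz.symm), key z y (hz.trans hy.symm)⟩)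

/-- The Hausdorff dimension of the Cantor set is at most `d` if, along some sequence of ranks, the
coverings by the intervals of `ediam_transfer_image_le` have bounded cost. -/
theorem dimH_transfer_le {n n' : ℕ → ℕ} (hn : IsBasicSeq n) (hn' : IsBasicSeq n')
    (hle : ∀ k, 1 ≤ k → n' k ≤ n k) {d : ℝ≥0} {m : ℕ → ℕ} (hm : Tendsto m atTop atTop)
    (hd : ∀ s, (partialProd n' (m s) : ℝ) *
      ((n' (m s + 1) : ℝ) / partialProd n (m s + 1)) ^ (d : ℝ) ≤ 1) :
    dimH (transfer n n' '' Ico 0 1) ≤ d := by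
  refine dimH_le_of_hausdorffMeasure_ne_top (ne_top_of_le_ne_top ENNReal.one_ne_top ?_)
  have hlim : Tendsto (fun s => ENNReal.ofReal ((n' (m s + 1) : ℝ) / partialProd n (m s + 1)))
      atTop (𝓝 0) := by
    have h0 : Tendsto (fun s => (partialProd n (m s) : ℝ)⁻¹) atTop (𝓝 0) :=
      (tendsto_partialProd hn).inv_tendsto_atTop.comp hm
    rw [← ENNReal.ofReal_zero]
    refine ENNReal.tendsto_ofReal (squeeze_zero (fun s => by positivity) (fun s => ?_) h0)
    have hP : (0 : ℝ) < partialProd n (m s) := by exact_mod_cast partialProd_pos hn (m s)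
    have h2 := hn (m s + 1) (by omega)
    have h3 : (0 : ℝ) < n (m s + 1) := by exact_mod_cast (by omega : 0 < n (m s + 1))
    have h4 : (n' (m s + 1) : ℝ) ≤ n (m s + 1) := by exact_mod_cast hle _ (by omega)
    rw [partialProd_succ, Nat.cast_mul, ← one_div, div_le_div_iff₀ (mul_pos hP h3) hP]
    nlinarith
  refine (MeasureTheory.Measure.hausdorffMeasure_le_liminf_sum (d : ℝ) _ _ hlim
    (fun s (j : Fin (partialProd n' (m s))) =>
      transfer n n' '' {y | ⌊y * partialProd n' (m s)⌋₊ = j})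
    (Eventually.of_forall fun s j => ediam_transfer_image_le hn hn' hle _ _)
    (Eventually.of_forall fun s => ?_)).trans ?_
  · rintro _ ⟨y, hy, rfl⟩
    have hQ : (0 : ℝ) < partialProd n' (m s) := by exact_mod_cast partialProd_pos hn' (m s)
    have hlt : ⌊y * partialProd n' (m s)⌋₊ < partialProd n' (m s) :=
      (Nat.floor_lt (mul_nonneg hy.1 hQ.le)).2 (mul_lt_of_lt_one_left hQ hy.2)
    exact mem_iUnion.2 ⟨⟨_, hlt⟩, y, rfl, rfl⟩
  · refine liminf_le_of_le (by isBoundedDefault) fun b hb => ?_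
    obtain ⟨s, hs⟩ := hb.exists
    refine hs.trans ?_
    calc _ ≤ ∑ j : Fin (partialProd n' (m s)),
          ENNReal.ofReal ((n' (m s + 1) : ℝ) / partialProd n (m s + 1)) ^ (d : ℝ) := by
          gcongr
          exact ediam_transfer_image_le hn hn' hle _ _
      _ = ENNReal.ofReal ((partialProd n' (m s) : ℝ) *
            ((n' (m s + 1) : ℝ) / partialProd n (m s + 1)) ^ (d : ℝ)) := by
          rw [ENNReal.ofReal_mul (by positivity),
            ← ENNReal.ofReal_rpow_of_nonneg (by positivity) d.coe_nonneg]
          simp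
      _ ≤ 1 := ENNReal.ofReal_le_one.2 (hd s)

/-! ### The sparse sequence -/

lemma isBasicSeq_sparseSeq : IsBasicSeq sparseSeq := by
  intro k hk
  unfold sparseSeq
  split_ifs
  · calc 2 ≤ 10 ^ 1 := by norm_num
      _ ≤ 10 ^ k := Nat.pow_le_pow_right (by norm_num) hk
  · exact le_rfl

lemma sparseSeq_le {k : ℕ} (hk : 1 ≤ k) : sparseSeq k ≤ 10 ^ k := by
  unfold sparseSeq
  split_ifs
  · exact le_rfl
  · calc 2 ≤ 10 ^ 1 := by norm_num
      _ ≤ 10 ^ k := Nat.pow_le_pow_right (by norm_num) hk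

open Classical in
/-- The number of digits allowed at place `k` in the Cantor set that witnesses unfaithfulness: the
square root of `sparseSeq k` where that is a large power of `10`, and both digits elsewhere. -/
noncomputable def sparseRoot (k : ℕ) : ℕ :=
  if ∃ s : ℕ, 1 ≤ s ∧ k = 10 ^ s then 10 ^ (k / 2) else 2

open Classical in
/-- The part of `sparseSeq` coming from the factors `2`. -/
noncomputable def binaryPart (k : ℕ) : ℕ :=
  if ∃ s : ℕ, 1 ≤ s ∧ k = 10 ^ s then 1 else 2

lemma sparseRoot_mul_self {s : ℕ} (hs : 1 ≤ s) :
    sparseRoot (10 ^ s) * sparseRoot (10 ^ s) = sparseSeq (10 ^ s) := by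
  have h : ∃ t : ℕ, 1 ≤ t ∧ 10 ^ s = 10 ^ t := ⟨s, hs, rfl⟩
  rw [sparseRoot, sparseSeq, if_pos h, if_pos h, ← pow_add]
  obtain ⟨r, rfl⟩ := Nat.exists_eq_add_of_le hs
  congr 1
  rw [pow_add]
  omega

lemma sparseSeq_mul_binaryPart (k : ℕ) :
    sparseSeq k * binaryPart k = sparseRoot k * sparseRoot k := by
  by_cases h : ∃ s : ℕ, 1 ≤ s ∧ k = 10 ^ s
  · obtain ⟨s, hs, rfl⟩ := id h
    rw [sparseRoot_mul_self hs, binaryPart, if_pos h, mul_one]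
  · simp [sparseSeq, sparseRoot, binaryPart, h]

lemma isBasicSeq_sparseRoot : IsBasicSeq sparseRoot := by
  intro k hk
  unfold sparseRoot
  split_ifs with h
  · obtain ⟨s, hs, rfl⟩ := h
    have : 10 ^ 1 ≤ 10 ^ s := Nat.pow_le_pow_right (by norm_num) hs
    calc 2 ≤ 10 ^ 1 := by norm_num
      _ ≤ 10 ^ (10 ^ s / 2) := Nat.pow_le_pow_right (by norm_num) (by omega)
  · exact le_rfl

lemma sparseRoot_le_sparseSeq (k : ℕ) : sparseRoot k ≤ sparseSeq k := by
  unfold sparseRoot sparseSeq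
  split_ifs
  · exact Nat.pow_le_pow_right (by norm_num) (Nat.div_le_self k 2)
  · exact le_rfl

lemma partialProd_mul_binaryPart (m : ℕ) :
    partialProd sparseSeq m * partialProd binaryPart m = partialProd sparseRoot m ^ 2 := by
  simp only [partialProd, ← Finset.prod_mul_distrib, sparseSeq_mul_binaryPart, sq]

lemma partialProd_binaryPart_le (m : ℕ) : partialProd binaryPart m ≤ 2 ^ m := by
  induction m with
  | zero => simp [partialProd_zero]
  | succ m ih =>
    rw [partialProd_succ, pow_succ]
    refine Nat.mul_le_mul ih ?_
    unfold binaryPart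
    split_ifs <;> norm_num

/-- Up to place `m` there are `Nat.log 10 m` places at which `sparseSeq` is not `2`. The largest of
these places is `10 ^ Nat.log 10 m`, and they add up to at most twice as much. -/
lemma partialProd_binaryPart_and_sparseSeq {m : ℕ} (hm : 1 ≤ m) :
    partialProd binaryPart m * 2 ^ Nat.log 10 m = 2 ^ m ∧
      partialProd sparseSeq m ≤ partialProd binaryPart m * 10 ^ (2 * 10 ^ Nat.log 10 m) := by
  induction m, hm using Nat.le_induction with
  | base =>
    have h : ¬ ∃ s : ℕ, 1 ≤ s ∧ 1 = 10 ^ s := by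
      rintro ⟨s, hs, h⟩
      have : 10 ^ 1 ≤ 10 ^ s := Nat.pow_le_pow_right (by norm_num) hs
      omega
    simp [partialProd, binaryPart, sparseSeq, h]
  | succ m hm ih =>
    obtain ⟨ih1, ih2⟩ := ih
    have hlow : 10 ^ Nat.log 10 m ≤ m := Nat.pow_log_le_self 10 (by omega)
    have hhigh : m < 10 ^ (Nat.log 10 m + 1) := Nat.lt_pow_succ_log_self (by norm_num) m
    rw [partialProd_succ, partialProd_succ]
    by_cases h : ∃ s : ℕ, 1 ≤ s ∧ m + 1 = 10 ^ s
    · rw [binaryPart, sparseSeq, if_pos h, if_pos h]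
      obtain ⟨s, hs, hms⟩ := h
      have hlog : Nat.log 10 (m + 1) = s := by rw [hms, Nat.log_pow (by norm_num)]
      have hlog' : Nat.log 10 m + 1 = s := by
        have h1 : s ≤ Nat.log 10 m + 1 :=
          (Nat.pow_le_pow_iff_right (by norm_num : 1 < 10)).1 (by omega)
        have h2 : Nat.log 10 m < s :=
          (Nat.pow_lt_pow_iff_right (by norm_num : 1 < 10)).1 (by omega)
        omega
      rw [hlog, ← hlog', mul_one]
      refine ⟨by rw [pow_succ, ← mul_assoc, ih1, pow_succ], ?_⟩
      calc _ ≤ partialProd binaryPart m * 10 ^ (2 * 10 ^ Nat.log 10 m) * 10 ^ (m + 1) :=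
            Nat.mul_le_mul_right _ ih2
        _ ≤ _ := by
            rw [mul_assoc, ← pow_add]
            refine Nat.mul_le_mul_left _ (Nat.pow_le_pow_right (by norm_num) ?_)
            rw [hms, ← hlog', pow_succ]
            omega
    · rw [binaryPart, sparseSeq, if_neg h, if_neg h]
      have hlog : Nat.log 10 (m + 1) = Nat.log 10 m := by
        refine Nat.log_eq_of_pow_le_of_lt_pow (by omega) (lt_of_le_of_ne hhigh fun h' => h ?_)
        exact ⟨_, by omega, h'⟩
      rw [hlog]
      refine ⟨by rw [pow_succ, ← ih1]; ring, ?_⟩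
      calc _ ≤ partialProd binaryPart m * 10 ^ (2 * 10 ^ Nat.log 10 m) * 2 :=
            Nat.mul_le_mul_right _ ih2
        _ = _ := by ring

lemma partialProd_sparseSeq_le_binaryPart_mul (m : ℕ) :
    partialProd sparseSeq m ≤ partialProd binaryPart m * 10 ^ (2 * m) := by
  rcases Nat.eq_zero_or_pos m with rfl | hm
  · simp [partialProd_zero]
  · refine (partialProd_binaryPart_and_sparseSeq hm).2.trans (Nat.mul_le_mul_left _ ?_)
    exact Nat.pow_le_pow_right (by norm_num)
      (Nat.mul_le_mul_left _ (Nat.pow_log_le_self 10 (by omega)))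

lemma partialProd_sparseSeq_le (m : ℕ) : partialProd sparseSeq m ≤ 10 ^ (3 * m) := by
  calc _ ≤ _ := partialProd_sparseSeq_le_binaryPart_mul m
    _ ≤ 10 ^ m * 10 ^ (2 * m) := Nat.mul_le_mul_right _
        ((partialProd_binaryPart_le m).trans (Nat.pow_le_pow_left (by norm_num) m))
    _ = _ := by rw [← pow_add]; congr 1; ring

lemma nine_mul_le_ten_pow (l : ℕ) : 9 * l ≤ 10 ^ l := by
  induction l with
  | zero => simp
  | succ l ih =>
    have := Nat.one_le_pow l 10 (by norm_num)
    rw [pow_succ]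
    omega

lemma partialProd_sparseSeq_le_pow (m : ℕ) :
    partialProd sparseSeq m ≤ partialProd binaryPart m ^ 10 := by
  rcases Nat.eq_zero_or_pos m with rfl | hm
  · simp [partialProd_zero]
  have hlog : 9 * Nat.log 10 m ≤ m :=
    (nine_mul_le_ten_pow _).trans (Nat.pow_log_le_self 10 (by omega))
  have hD : partialProd binaryPart m = 2 ^ (m - Nat.log 10 m) := by
    refine Nat.eq_of_mul_eq_mul_right (pow_pos two_pos (Nat.log 10 m)) ?_
    rw [(partialProd_binaryPart_and_sparseSeq hm).1, ← pow_add]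
    congr 1
    omega
  refine (partialProd_sparseSeq_le_binaryPart_mul m).trans ?_
  rw [pow_succ' _ 9]
  refine Nat.mul_le_mul_left _ ?_
  calc 10 ^ (2 * m) = 100 ^ m := by rw [pow_mul]; norm_num
    _ ≤ 256 ^ m := Nat.pow_le_pow_left (by norm_num) m
    _ = 2 ^ (8 * m) := by rw [pow_mul]; norm_num
    _ ≤ 2 ^ ((m - Nat.log 10 m) * 9) := Nat.pow_le_pow_right (by norm_num) (by omega)
    _ = _ := by rw [hD, ← pow_mul]

lemma partialProd_sparseSeq_rpow_le (m : ℕ) :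
    (partialProd sparseSeq m : ℝ) ^ ((11 / 20 : ℝ≥0) : ℝ) ≤ partialProd sparseRoot m := by
  have h : partialProd sparseSeq m ^ 11 ≤ partialProd sparseRoot m ^ 20 := by
    calc _ = partialProd sparseSeq m ^ 10 * partialProd sparseSeq m := pow_succ _ _
      _ ≤ partialProd sparseSeq m ^ 10 * partialProd binaryPart m ^ 10 :=
          Nat.mul_le_mul_left _ (partialProd_sparseSeq_le_pow m)
      _ = _ := by rw [← mul_pow, partialProd_mul_binaryPart, ← pow_mul]
  have h' : (partialProd sparseSeq m : ℝ) ^ 11 ≤ (partialProd sparseRoot m : ℝ) ^ 20 := by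
    exact_mod_cast h
  refine le_of_pow_le_pow_left₀ (n := 20) (by norm_num) (by positivity) ?_
  refine le_trans (le_of_eq ?_) h'
  rw [← Real.rpow_natCast, ← Real.rpow_mul (by positivity), ← Real.rpow_natCast]
  norm_num

lemma sparse_cover_cost_le {s : ℕ} (hs : 1 ≤ s) :
    (partialProd sparseRoot (10 ^ s - 1) : ℝ) *
      ((sparseRoot (10 ^ s - 1 + 1) : ℝ) / partialProd sparseSeq (10 ^ s - 1 + 1)) ^
        ((1 / 2 : ℝ≥0) : ℝ) ≤ 1 := by
  have h1 : 10 ^ s - 1 + 1 = 10 ^ s := Nat.sub_add_cancel (Nat.one_le_pow _ _ (by norm_num))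
  have hD : partialProd binaryPart (10 ^ s - 1) ≤ sparseRoot (10 ^ s) := by
    obtain ⟨r, hr⟩ : ∃ r, 10 ^ s = 2 * r := by
      obtain ⟨t, rfl⟩ := Nat.exists_eq_add_of_le hs
      exact ⟨5 * 10 ^ t, by rw [pow_add]; ring⟩
    rw [sparseRoot, if_pos ⟨s, hs, rfl⟩]
    calc _ ≤ 2 ^ (10 ^ s - 1) := partialProd_binaryPart_le _
      _ ≤ 2 ^ (2 * r) := Nat.pow_le_pow_right (by norm_num) (by omega)
      _ = 4 ^ r := by rw [pow_mul]; norm_num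
      _ ≤ 10 ^ r := Nat.pow_le_pow_left (by norm_num) r
      _ = _ := by rw [hr, Nat.mul_div_cancel_left _ two_pos]
  have hP : partialProd sparseSeq (10 ^ s) =
      partialProd sparseSeq (10 ^ s - 1) * sparseSeq (10 ^ s) := by
    conv_lhs => rw [← h1, partialProd_succ, h1]
  have hnat : partialProd sparseRoot (10 ^ s - 1) ^ 2 * sparseRoot (10 ^ s) ≤
      partialProd sparseSeq (10 ^ s) := by
    rw [← partialProd_mul_binaryPart, hP, ← sparseRoot_mul_self hs, ← mul_assoc]
    exact Nat.mul_le_mul_right _ (Nat.mul_le_mul_left _ hD)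
  have hreal : (partialProd sparseRoot (10 ^ s - 1) : ℝ) ^ 2 * sparseRoot (10 ^ s) ≤
      partialProd sparseSeq (10 ^ s) := by exact_mod_cast hnat
  have hpos : (0 : ℝ) < partialProd sparseSeq (10 ^ s) := by
    exact_mod_cast partialProd_pos isBasicSeq_sparseSeq _
  rw [h1]
  push_cast
  rw [← Real.sqrt_eq_rpow]
  refine le_of_pow_le_pow_left₀ (n := 2) (by norm_num) (by positivity) ?_
  rw [mul_pow, Real.sq_sqrt (by positivity), one_pow, ← mul_div_assoc, div_le_one hpos]
  exact hreal

theorem not_isFaithful_sparseSeq : ¬ IsFaithful (cylinders sparseSeq) := by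
  intro hf
  have hle : ∀ k, 1 ≤ k → sparseRoot k ≤ sparseSeq k := fun k _ => sparseRoot_le_sparseSeq k
  have hE : transfer sparseSeq sparseRoot '' Ico 0 1 ⊆ Icc (0 : ℝ) 1 := by
    rintro _ ⟨y, -, rfl⟩
    exact (isExpansion_transfer isBasicSeq_sparseSeq isBasicSeq_sparseRoot hle y).mem_Icc
      isBasicSeq_sparseSeq
  have hupper : dimH (transfer sparseSeq sparseRoot '' Ico 0 1) ≤ (1 / 2 : ℝ≥0) := by
    refine dimH_transfer_le isBasicSeq_sparseSeq isBasicSeq_sparseRoot hle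
      (m := fun s => 10 ^ (s + 1) - 1) ?_ fun s => sparse_cover_cost_le (by omega)
    refine tendsto_atTop_mono (fun s => ?_) tendsto_id
    have := Nat.lt_pow_self (n := s + 1) (by norm_num : 1 < 10)
    simp only [id]
    omega
  have hlower := le_dimHOf_transfer isBasicSeq_sparseSeq isBasicSeq_sparseRoot hle
    partialProd_sparseSeq_rpow_le
  rw [← hf.2 _ hE] at hlower
  have h : (11 / 20 : ℝ≥0) ≤ 1 / 2 := by exact_mod_cast hlower.trans hupper
  have h' : ((11 / 20 : ℝ≥0) : ℝ) ≤ ((1 / 2 : ℝ≥0) : ℝ) := by exact_mod_cast h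
  norm_num at h'

theorem not_tendsto_log_sparseSeq :
    ¬ Tendsto (fun k : ℕ => Real.log (sparseSeq k : ℝ) /
      Real.log (partialProd sparseSeq (k - 1) : ℝ)) atTop (𝓝 0) := by
  intro h
  have hsub : Tendsto (fun s : ℕ => 10 ^ (s + 1)) atTop atTop :=
    (tendsto_pow_atTop_atTop_of_one_lt (by norm_num : 1 < 10)).comp (tendsto_add_atTop_nat 1)
  obtain ⟨s, hs⟩ := ((h.comp hsub).eventually_lt_const (by norm_num : (0 : ℝ) < 1 / 3)).exists
  refine absurd hs (not_lt.2 ?_)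
  have hk : 10 ≤ 10 ^ (s + 1) := by
    rw [pow_succ]
    have := Nat.one_le_pow s 10 (by norm_num)
    omega
  simp only [Function.comp_apply]
  rw [show sparseSeq (10 ^ (s + 1)) = 10 ^ (10 ^ (s + 1)) from if_pos ⟨s + 1, by omega, rfl⟩]
  generalize 10 ^ (s + 1) = k at hk
  have hP1 : (1 : ℝ) < partialProd sparseSeq (k - 1) := by
    have := two_pow_le_partialProd isBasicSeq_sparseSeq (k - 1)
    have h2 := Nat.one_lt_pow (by omega : k - 1 ≠ 0) one_lt_two
    exact_mod_cast lt_of_lt_of_le h2 this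
  have hP2 : (partialProd sparseSeq (k - 1) : ℝ) ≤ 10 ^ (3 * k) := by
    exact_mod_cast (partialProd_sparseSeq_le (k - 1)).trans
      (Nat.pow_le_pow_right (by norm_num) (by omega))
  have hlog := Real.log_le_log (by linarith) hP2
  rw [Real.log_pow] at hlog
  rw [le_div_iff₀ (Real.log_pos hP1)]
  push_cast at hlog ⊢
  rw [Real.log_pow]
  linarith

end CantorSeries

theorem mainTheorem3 :
    CantorSeries.IsBasicSeq CantorSeries.sparseSeq ∧
    (∀ k : ℕ, 1 ≤ k → CantorSeries.sparseSeq k ≤ 10 ^ k) ∧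
    CantorSeries.IsSubgeometric CantorSeries.sparseSeq ∧
    ¬ Tendsto (fun k : ℕ => Real.log (CantorSeries.sparseSeq k : ℝ) /
        Real.log (CantorSeries.partialProd CantorSeries.sparseSeq (k - 1) : ℝ)) atTop (𝓝 0) ∧
    CantorSeries.IsLocallyFine (CantorSeries.cylinders CantorSeries.sparseSeq) ∧
    ¬ CantorSeries.IsFaithful (CantorSeries.cylinders CantorSeries.sparseSeq) :=
  ⟨CantorSeries.isBasicSeq_sparseSeq, fun _ => CantorSeries.sparseSeq_le,
    ⟨10, by norm_num, fun _ => CantorSeries.sparseSeq_le⟩, CantorSeries.not_tendsto_log_sparseSeq,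
    CantorSeries.isLocallyFine_cylinders CantorSeries.isBasicSeq_sparseSeq,
    CantorSeries.not_isFaithful_sparseSeq⟩
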